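/- A \emph{1D-QAC circuit of depth $d$} on a line of $N$ qubits is a product $C=L_dM_d\cdots L_1M_1L_0$, where each $L_k$ is a tensor product of arbitrary single-qubit unitaries, and each $M_k$ is a product of multi-qubit $CZ$ gates whose supports are pairwise disjoint contiguous intervals of the line, of any size (the $CZ$ gate with support $S$ maps a computational basis state $|y\rangle$ to $-|y\rangle$ if $y_i=1$ for all $i\in S$, and to $|y\rangle$ otherwise). Suppose that $n$ of the $N$ qubits are input qubits and that the input qubits form a contiguous interval of the line. The other $N-n$ qubits are ancillas; their number is arbitrary, and they start in an arbitrary fixed pure state $|\varphi\rangle$, independent of the input. On input $x\in\{0,1\}^n$ the circuit is applied to $|x\rangle\otimes|\varphi\rangle$ and then one fixed output qubit, which may be any qubit of the line, is measured in the computational basis; let $g_C(x)\in\{0,1\}$ be the outcome. Write $\mathrm{PARITY}_n(x)=x_1\oplus\cdots\oplus x_n$. Theorem. Let $n,d\ge 1$ be integers. For every such circuit $C$ of depth $d$ with $n$ contiguous input qubits, $$\Pr_{x,C}\bigl[g_C(x)=\mathrm{PARITY}_n(x)\bigr]\;\le\;\frac12+8dn\cdot 2^{-n/(10d)},$$ where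 $x$ is uniform on $\{0,1\}^n$ and the probability is also over the measurement. In particular, depth $\Omega(n/\log n)$ is needed to compute $\mathrm{PARITY}_n$ with average-case probability at least $2/3$: there is an absolute constant $c>0$ such that for every $n\ge 2$, every such circuit with $\Pr_{x,C}[g_C(x)=\mathrm{PARITY}_n(x)]\ge \frac23$, whatever its number of ancillas and their initial state, has depth at least $c\,n/\log n$. -/

import Mathlib

/-- A computational basis string of a line of `N` qubits. -/
abbrev Bits (N : ℕ) : Type := Fin N → Fin 2

/-- Operators on the `2 ^ N`-dimensional space of `N` qubits, as matrices in the computational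
basis. -/
abbrev QOp (N : ℕ) : Type := Matrix (Bits N) (Bits N) ℂ

/-- A layer of single-qubit unitaries: one arbitrary unitary for each qubit. -/
abbrev SingleLayer (N : ℕ) : Type := Fin N → Matrix.unitaryGroup (Fin 2) ℂ

/-- The operator of a layer of single-qubit unitaries: the tensor product `⨂ i, L i`. -/
def SingleLayer.op {N : ℕ} (L : SingleLayer N) : QOp N :=
  Matrix.of fun y z => ∏ i, (L i : Matrix (Fin 2) (Fin 2) ℂ) (y i) (z i)

/-- The multi-qubit controlled-`Z` gate with support `S`: it flips the sign of the basis vectors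
whose bits in `S` are all `1`, and fixes the other basis vectors. -/
def czGate {N : ℕ} (S : Finset (Fin N)) : QOp N :=
  Matrix.diagonal fun y => if ∀ i ∈ S, y i = 1 then -1 else 1

/-- A layer of controlled-`Z` gates on a line of `N` qubits: the supports of the gates are nonempty
contiguous intervals of any size, and they are pairwise disjoint. -/
structure CZLayer (N : ℕ) where
  gates : List (Finset (Fin N))
  interval : ∀ S ∈ gates, ∃ a b : Fin N, a ≤ b ∧ S = Finset.Icc a b
  disjoint : gates.Pairwise Disjoint

/-- The operator of a layer of controlled-`Z` gates: the product of the (commuting) gates. -/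
def CZLayer.op {N : ℕ} (M : CZLayer N) : QOp N :=
  (M.gates.map czGate).prod

/-- One-dimensional QAC circuits `L_d M_d ⋯ L_1 M_1 L_0` on a line of `N` qubits, indexed by their
depth `d`, the number of layers of controlled-`Z` gates. -/
inductive OneDQAC (N : ℕ) : ℕ → Type
  | init (L : SingleLayer N) : OneDQAC N 0
  | layer {d : ℕ} (C : OneDQAC N d) (M : CZLayer N) (L : SingleLayer N) : OneDQAC N (d + 1)

/-- The operator computed by a circuit. -/
def OneDQAC.op {N : ℕ} : {d : ℕ} → OneDQAC N d → QOp N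
  | _, .init L => L.op
  | _, .layer C M L => L.op * M.op * C.op

/-- A placement of `n` input qubits on a line of `N` qubits is contiguous if the qubits that it
occupies form an interval of the line. -/
def IsContiguous {n N : ℕ} (e : Fin n ↪ Fin N) : Prop :=
  (Set.range e).OrdConnected

/-- The ancilla qubits: those that hold no input bit. -/
abbrev Ancilla {n N : ℕ} (e : Fin n ↪ Fin N) : Type := {q : Fin N // q ∉ Set.range e}

/-- The space of pure states of the ancilla qubits. -/
abbrev AncillaState {n N : ℕ} (e : Fin n ↪ Fin N) : Type :=
  EuclideanSpace ℂ (Ancilla e → Fin 2)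

/-- The initial state `|x⟩ ⊗ |φ⟩`, with `|x⟩` on the input qubits and `|φ⟩` on the ancilla qubits. -/
noncomputable def initialState {n N : ℕ} (e : Fin n ↪ Fin N) (φ : AncillaState e) (x : Bits n) :
    Bits N → ℂ :=
  fun y => if ∀ i, y (e i) = x i then φ (fun q => y q) else 0

/-- The probability that measuring qubit `q` of the state `ψ` in the computational basis gives the
outcome `b`. -/
noncomputable def measureProb {N : ℕ} (ψ : Bits N → ℂ) (q : Fin N) (b : Fin 2) : ℝ :=
  ∑ y : Bits N with y q = b, ‖ψ y‖ ^ 2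

/-- The parity of a bit string: the sum of its bits modulo `2`. -/
def parity {n : ℕ} (x : Bits n) : Fin 2 := ∑ i, x i

/-- The average-case probability that the circuit `C`, with inputs placed by `e`, ancilla state `φ`
and output qubit `q`, computes the parity of its input: the probability, over a uniformly random
input `x` and the final measurement, that the outcome is the parity of `x`. -/
noncomputable def paritySuccess {n N d : ℕ} (C : OneDQAC N d) (e : Fin n ↪ Fin N)
    (φ : AncillaState e) (q : Fin N) : ℝ :=
  (∑ x : Bits n, measureProb (C.op.mulVec (initialState e φ x)) q (parity x)) / 2 ^ n

/-! Collect the initial states for all inputs as the columns of a matrix Ψ (`stateMatrix`), so that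
squared Frobenius norms are 2^n times averages over a uniform input. Since Ψ Ψᴴ is the identity on
the input qubits tensored with |φ⟩⟨φ|, the inputs are maximally mixed on average. If the observables
on k qubits pull back through the preceding circuit to observables on the inputs, those k qubits are
all 1 with probability only 2^(-k) (`trace_onesProj`).

A CZ gate covering k such consecutive qubits, however long it is, therefore acts almost as the
identity and can be deleted at small cost (`norm_czGate_sub_one_mul_stateMatrix_le`). By
disjointness, a layer has at most n of these gates. A surviving gate that crosses an edge of the
light cone inside the controlled zone reaches at most k positions beyond it
(`subset_or_disjoint_of_not_containsWindow`). So the edges of the cone move by at most k per layer,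
while the controlled zone loses k positions at each end (`exists_unitary_close_with_light_cone`).

When 2dk + 2 ≤ n, the cone of the output qubit misses the first or the last input. Flipping that
input changes the parity but not the output distribution, so the modified circuit succeeds with
probability exactly 1/2 (`norm_parityPart_sq_of_light_cone`). The choice k ≈ n/(5d) gives the bound.
-/

open scoped Matrix

/-! ### Tensor products and single-qubit operators -/

/-- The tensor product of one `2 × 2` matrix for each qubit. -/
def tensorOp {N : ℕ} (f : Fin N → Matrix (Fin 2) (Fin 2) ℂ) : QOp N :=
  Matrix.of fun y z => ∏ i, f i (y i) (z i)

theorem tensorOp_mul {N : ℕ} (f g : Fin N → Matrix (Fin 2) (Fin 2) ℂ) :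
    tensorOp f * tensorOp g = tensorOp (f * g) := by
  ext y z
  simp only [tensorOp, Matrix.mul_apply, Matrix.of_apply, Pi.mul_apply, ← Finset.prod_mul_distrib]
  exact (Fintype.prod_sum fun i b => f i (y i) b * g i b (z i)).symm

theorem tensorOp_one {N : ℕ} : tensorOp (1 : Fin N → Matrix (Fin 2) (Fin 2) ℂ) = 1 := by
  ext y z
  by_cases h : y = z
  · subst h; simp [tensorOp]
  · obtain ⟨i, hi⟩ := Function.ne_iff.1 h
    rw [Matrix.one_apply_ne h]
    exact Finset.prod_eq_zero (Finset.mem_univ i) (by simp [hi])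

theorem tensorOp_conjTranspose {N : ℕ} (f : Fin N → Matrix (Fin 2) (Fin 2) ℂ) :
    (tensorOp f)ᴴ = tensorOp fun i => (f i)ᴴ := by
  ext y z
  simp [tensorOp, Matrix.conjTranspose_apply]

/-- The operator that acts as `M` on qubit `i` and trivially elsewhere. -/
def siteOp {N : ℕ} (i : Fin N) (M : Matrix (Fin 2) (Fin 2) ℂ) : QOp N :=
  tensorOp (Pi.mulSingle i M)

theorem siteOp_mul {N : ℕ} (i : Fin N) (M M' : Matrix (Fin 2) (Fin 2) ℂ) :
    siteOp i M * siteOp i M' = siteOp i (M * M') := by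
  rw [siteOp, siteOp, tensorOp_mul, ← Pi.mulSingle_mul, siteOp]

theorem siteOp_one {N : ℕ} (i : Fin N) : siteOp i 1 = 1 := by
  rw [siteOp, Pi.mulSingle_one, tensorOp_one]

theorem siteOp_conjTranspose {N : ℕ} (i : Fin N) (M : Matrix (Fin 2) (Fin 2) ℂ) :
    (siteOp i M)ᴴ = siteOp i Mᴴ := by
  rw [siteOp, tensorOp_conjTranspose, siteOp]
  congr 1
  ext1 j
  by_cases h : j = i
  · subst h; simp
  · simp [h]

theorem siteOp_commute {N : ℕ} {i j : Fin N} (h : i ≠ j) (M M' : Matrix (Fin 2) (Fin 2) ℂ) :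
    Commute (siteOp i M) (siteOp j M') := by
  have := Pi.mulSingle_commute (f := fun _ : Fin N => Matrix (Fin 2) (Fin 2) ℂ) h M M'
  rw [Commute, SemiconjBy] at this ⊢
  rw [siteOp, siteOp, tensorOp_mul, tensorOp_mul, this]

theorem siteOp_apply {N : ℕ} (i : Fin N) (M : Matrix (Fin 2) (Fin 2) ℂ) (y z : Bits N) :
    siteOp i M y z = if ∀ j, j ≠ i → y j = z j then M (y i) (z i) else 0 := by
  simp only [siteOp, tensorOp, Matrix.of_apply]
  rw [← Finset.mul_prod_erase _ _ (Finset.mem_univ i), Pi.mulSingle_eq_same]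
  have : ∏ j ∈ Finset.univ.erase i, (Pi.mulSingle i M : Fin N → Matrix (Fin 2) (Fin 2) ℂ) j (y j) (z j)
      = ∏ j ∈ Finset.univ.erase i, if y j = z j then 1 else 0 := by
    refine Finset.prod_congr rfl fun j hj => ?_
    rw [Pi.mulSingle_eq_of_ne (Finset.ne_of_mem_erase hj), Matrix.one_apply]
  rw [this, Finset.prod_ite_zero]
  simp

theorem siteOp_add {N : ℕ} (i : Fin N) (M M' : Matrix (Fin 2) (Fin 2) ℂ) :
    siteOp i (M + M') = siteOp i M + siteOp i M' := by
  ext y z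
  simp only [Matrix.add_apply, siteOp_apply]
  split_ifs <;> simp

theorem sum_bits_agree {N : ℕ} {R : Type*} [AddCommMonoid R] (i : Fin N) (y : Bits N)
    (f : Bits N → R) :
    (∑ w : Bits N, if ∀ j, j ≠ i → y j = w j then f w else 0) =
      ∑ b : Fin 2, f (Function.update y i b) := by
  rw [← Finset.sum_filter]
  symm
  refine Finset.sum_bij (fun b _ => Function.update y i b) ?_ ?_ ?_ ?_
  · intro b _
    simp only [Finset.mem_filter, Finset.mem_univ, true_and]
    intro j hj
    simp [hj]
  · intro b _ b' _ h
    simpa using congrFun h i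
  · intro w hw
    refine ⟨w i, Finset.mem_univ _, ?_⟩
    simp only [Finset.mem_filter, Finset.mem_univ, true_and] at hw
    ext1 j
    by_cases h : j = i
    · subst h; simp
    · simp [h, hw j h]
  · simp

theorem siteOp_mul_apply {N : ℕ} {m : Type*} (i : Fin N) (M : Matrix (Fin 2) (Fin 2) ℂ)
    (A : Matrix (Bits N) m ℂ) (y : Bits N) (x : m) :
    (siteOp i M * A) y x = ∑ b : Fin 2, M (y i) b * A (Function.update y i b) x := by
  simp only [Matrix.mul_apply, siteOp_apply, ite_mul, zero_mul]
  rw [sum_bits_agree i y fun w => M (y i) (w i) * A w x]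
  simp

theorem mul_siteOp_apply {N : ℕ} {m : Type*} (i : Fin N) (M : Matrix (Fin 2) (Fin 2) ℂ)
    (A : Matrix m (Bits N) ℂ) (y : Bits N) (x : m) :
    (A * siteOp i M) x y = ∑ b : Fin 2, A x (Function.update y i b) * M b (y i) := by
  simp only [Matrix.mul_apply, siteOp_apply, mul_ite, mul_zero]
  have h := sum_bits_agree i y fun w => A x w * M (w i) (y i)
  simp only [Function.update_self] at h
  rw [← h]
  refine Finset.sum_congr rfl fun w _ => ?_
  simp only [eq_comm]

theorem SingleLayer.op_eq_tensorOp {N : ℕ} (L : SingleLayer N) :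
    L.op = tensorOp fun i => (L i : Matrix (Fin 2) (Fin 2) ℂ) := rfl

theorem SingleLayer.op_mem_unitary {N : ℕ} (L : SingleLayer N) :
    L.op ∈ Matrix.unitaryGroup (Bits N) ℂ := by
  rw [Matrix.mem_unitaryGroup_iff, Matrix.star_eq_conjTranspose, L.op_eq_tensorOp,
    tensorOp_conjTranspose, tensorOp_mul, ← tensorOp_one]
  congr 1
  ext1 i
  exact (Matrix.mem_unitaryGroup_iff).1 (L i).2

theorem SingleLayer.conj_siteOp {N : ℕ} (L : SingleLayer N) (i : Fin N)
    (M : Matrix (Fin 2) (Fin 2) ℂ) :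
    L.opᴴ * siteOp i M * L.op =
      siteOp i ((L i : Matrix (Fin 2) (Fin 2) ℂ)ᴴ * M * (L i : Matrix (Fin 2) (Fin 2) ℂ)) := by
  rw [L.op_eq_tensorOp, tensorOp_conjTranspose, siteOp, tensorOp_mul, tensorOp_mul, siteOp]
  congr 1
  ext1 j
  by_cases h : j = i
  · subst h; simp
  · have := (Matrix.mem_unitaryGroup_iff').1 (L j).2
    rw [Matrix.star_eq_conjTranspose] at this
    simp [h, this]

/-! ### Local algebras and pullback of observables -/

/-- The algebra of operators supported on the qubits in `R`. -/
def localAlg {N : ℕ} (R : Set (Fin N)) : Subalgebra ℂ (QOp N) :=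
  Algebra.adjoin ℂ {T | ∃ i ∈ R, ∃ M, T = siteOp i M}

theorem siteOp_mem_localAlg {N : ℕ} {R : Set (Fin N)} {i : Fin N} (h : i ∈ R)
    (M : Matrix (Fin 2) (Fin 2) ℂ) : siteOp i M ∈ localAlg R :=
  Algebra.subset_adjoin ⟨i, h, M, rfl⟩

theorem localAlg_mono {N : ℕ} {R R' : Set (Fin N)} (h : R ⊆ R') : localAlg R ≤ localAlg R' :=
  Algebra.adjoin_mono fun _ ⟨i, hi, M, hM⟩ => ⟨i, h hi, M, hM⟩

theorem localAlg_induction {N : ℕ} {R : Set (Fin N)} {p : QOp N → Prop}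
    (site : ∀ i ∈ R, ∀ M, p (siteOp i M)) (scalar : ∀ c : ℂ, p (algebraMap ℂ _ c))
    (add : ∀ A B, p A → p B → p (A + B)) (mul : ∀ A B, p A → p B → p (A * B))
    {A : QOp N} (hA : A ∈ localAlg R) : p A := by
  induction hA using Algebra.adjoin_induction with
  | mem x hx => obtain ⟨i, hi, M, rfl⟩ := hx; exact site i hi M
  | algebraMap r => exact scalar r
  | add x y _ _ hx hy => exact add x y hx hy
  | mul x y _ _ hx hy => exact mul x y hx hy

theorem commute_of_mem_localAlg {N : ℕ} {R : Set (Fin N)} {A B : QOp N} (hA : A ∈ localAlg R)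
    (hB : ∀ i ∈ R, ∀ M, Commute (siteOp i M) B) : Commute A B :=
  localAlg_induction (p := fun A => Commute A B) hB (fun c => Algebra.commute_algebraMap_left c B)
    (fun _ _ => Commute.add_left) (fun _ _ => Commute.mul_left) hA

/-- Conjugation by `U` maps observables on `R` to observables on `R'`. -/
def PullsBack {N : ℕ} (U : QOp N) (R R' : Set (Fin N)) : Prop :=
  ∀ A ∈ localAlg R, Uᴴ * A * U ∈ localAlg R'

theorem conj_mul_conj {N : ℕ} {U : QOp N} (hU : U ∈ Matrix.unitaryGroup (Bits N) ℂ) (A B : QOp N) :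
    (Uᴴ * A * U) * (Uᴴ * B * U) = Uᴴ * (A * B) * U := by
  have h : U * Uᴴ = 1 := Matrix.mem_unitaryGroup_iff.1 hU
  calc _ = Uᴴ * A * (U * Uᴴ) * B * U := by simp only [Matrix.mul_assoc]
    _ = _ := by rw [h]; simp only [Matrix.mul_assoc, Matrix.mul_one]

theorem PullsBack.of_siteOp {N : ℕ} {U : QOp N} (hU : U ∈ Matrix.unitaryGroup (Bits N) ℂ)
    {R R' : Set (Fin N)} (h : ∀ i ∈ R, ∀ M, Uᴴ * siteOp i M * U ∈ localAlg R') :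
    PullsBack U R R' := by
  have h1 : Uᴴ * U = 1 := Matrix.mem_unitaryGroup_iff'.1 hU
  intro A hA
  refine localAlg_induction (p := fun A => Uᴴ * A * U ∈ localAlg R') h (fun c => ?_)
    (fun A B hA hB => ?_) (fun A B hA hB => ?_) hA
  · rw [← Algebra.commutes, Matrix.mul_assoc, h1, Matrix.mul_one]
    exact Subalgebra.algebraMap_mem _ c
  · rw [Matrix.mul_add, Matrix.add_mul]; exact add_mem hA hB
  · rw [← conj_mul_conj hU]; exact mul_mem hA hB

theorem PullsBack.mul {N : ℕ} {U V : QOp N} {R R' R'' : Set (Fin N)} (hV : PullsBack V R R')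
    (hU : PullsBack U R' R'') : PullsBack (V * U) R R'' := by
  intro A hA
  have := hU _ (hV A hA)
  rwa [Matrix.conjTranspose_mul, show Uᴴ * Vᴴ * A * (V * U) = Uᴴ * (Vᴴ * A * V) * U by
    simp only [Matrix.mul_assoc]]

theorem SingleLayer.pullsBack {N : ℕ} (L : SingleLayer N) (R : Set (Fin N)) :
    PullsBack L.op R R :=
  .of_siteOp L.op_mem_unitary fun i hi M => by
    rw [L.conj_siteOp]; exact siteOp_mem_localAlg hi _

/-! ### CZ gates and their light cones -/

/-- The projection onto the basis vectors whose bits in `S` are all `1`. -/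
def onesProj {N : ℕ} (S : Finset (Fin N)) : QOp N :=
  Matrix.diagonal fun y => if ∀ i ∈ S, y i = 1 then 1 else 0

/-- The projection of a qubit onto the basis vector `b`. -/
def bitProj (b : Fin 2) : Matrix (Fin 2) (Fin 2) ℂ := Matrix.diagonal fun c => if c = b then 1 else 0

/-- The bit flip of one qubit. -/
def bitFlip : Matrix (Fin 2) (Fin 2) ℂ := Matrix.of fun b c => if b = c + 1 then 1 else 0

theorem siteOp_bitProj {N : ℕ} (i : Fin N) (b : Fin 2) :
    siteOp i (bitProj b) = Matrix.diagonal fun y => if y i = b then 1 else 0 := by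
  ext y z
  rw [siteOp_apply, bitProj]
  by_cases h : y = z
  · subst h; simp
  · rw [Matrix.diagonal_apply_ne _ h]
    split_ifs with h'
    · refine Matrix.diagonal_apply_ne _ fun hi => h (funext fun j => ?_)
      by_cases hj : j = i
      · rw [hj, hi]
      · exact h' j hj
    · rfl

theorem onesProj_empty {N : ℕ} : onesProj (∅ : Finset (Fin N)) = 1 := by
  simp [onesProj, Matrix.diagonal_one]

theorem onesProj_insert {N : ℕ} (i : Fin N) (S : Finset (Fin N)) :
    onesProj (insert i S) = siteOp i (bitProj 1) * onesProj S := by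
  rw [siteOp_bitProj, onesProj, onesProj, Matrix.diagonal_mul_diagonal]
  congr 1
  ext1 y
  by_cases h : y i = 1 <;> simp [h]

theorem onesProj_mem_localAlg {N : ℕ} {S : Finset (Fin N)} {R : Set (Fin N)} (h : (S : Set _) ⊆ R) :
    onesProj S ∈ localAlg R := by
  induction S using Finset.induction_on with
  | empty => rw [onesProj_empty]; exact one_mem _
  | insert i S _ ih =>
    rw [onesProj_insert]
    exact mul_mem (siteOp_mem_localAlg (h (by simp)) _)
      (ih fun j hj => h (by simpa using Or.inr hj))

theorem czGate_eq {N : ℕ} (S : Finset (Fin N)) : czGate S = 1 - (2 : ℂ) • onesProj S := by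
  rw [czGate, onesProj, ← Matrix.diagonal_one, ← Matrix.diagonal_smul, Matrix.diagonal_sub]
  congr 1
  ext1 y
  simp only [Pi.smul_apply]
  split_ifs <;> norm_num

theorem czGate_mem_localAlg {N : ℕ} {S : Finset (Fin N)} {R : Set (Fin N)} (h : (S : Set _) ⊆ R) :
    czGate S ∈ localAlg R := by
  rw [czGate_eq]
  exact sub_mem (one_mem _) (Subalgebra.smul_mem _ (onesProj_mem_localAlg h) _)

theorem czGate_conjTranspose {N : ℕ} (S : Finset (Fin N)) : (czGate S)ᴴ = czGate S := by
  rw [czGate, Matrix.diagonal_conjTranspose]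
  congr 1
  ext1 y
  simp only [Pi.star_apply]
  split_ifs <;> simp

theorem czGate_mul_self {N : ℕ} (S : Finset (Fin N)) : czGate S * czGate S = 1 := by
  rw [czGate, Matrix.diagonal_mul_diagonal, ← Matrix.diagonal_one]
  congr 1
  ext1 y
  split_ifs <;> simp

theorem czGate_commute {N : ℕ} (S T : Finset (Fin N)) : Commute (czGate S) (czGate T) :=
  Matrix.commute_diagonal _ _

/-- The product of the controlled-`Z` gates with the supports in a list. -/
def czProd {N : ℕ} (l : List (Finset (Fin N))) : QOp N := (l.map czGate).prod

theorem czProd_cons {N : ℕ} (S : Finset (Fin N)) (l : List (Finset (Fin N))) :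
    czProd (S :: l) = czGate S * czProd l := by simp [czProd]

theorem czGate_mem_unitary {N : ℕ} (S : Finset (Fin N)) :
    czGate S ∈ Matrix.unitaryGroup (Bits N) ℂ := by
  rw [Matrix.mem_unitaryGroup_iff, Matrix.star_eq_conjTranspose, czGate_conjTranspose,
    czGate_mul_self]

theorem czProd_mem_unitary {N : ℕ} (l : List (Finset (Fin N))) :
    czProd l ∈ Matrix.unitaryGroup (Bits N) ℂ :=
  Submonoid.list_prod_mem _ fun T hT => by
    obtain ⟨S, _, rfl⟩ := List.mem_map.1 hT
    exact czGate_mem_unitary S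

theorem czProd_commute_czGate {N : ℕ} (l : List (Finset (Fin N))) (S : Finset (Fin N)) :
    Commute (czProd l) (czGate S) :=
  Commute.list_prod_left _ _ fun T hT => by
    obtain ⟨S', _, rfl⟩ := List.mem_map.1 hT
    exact czGate_commute _ _

/-- A gate inside `R` is absorbed into the algebra; a gate commuting with `A` cancels against its
adjoint. Since CZ gates commute with each other, conjugating `A` by one gate preserves its
commutation with the others, which lets the induction run. -/
theorem czProd_conj_mem {N : ℕ} {R : Set (Fin N)} (l : List (Finset (Fin N))) :
    ∀ A ∈ localAlg R, (∀ S ∈ l, (S : Set _) ⊆ R ∨ Commute A (czGate S)) →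
      (czProd l)ᴴ * A * czProd l ∈ localAlg R := by
  induction l with
  | nil => intro A hA _; simpa [czProd] using hA
  | cons S l ih =>
    intro A hA h
    have key : (czProd (S :: l))ᴴ * A * czProd (S :: l) =
        (czProd l)ᴴ * (czGate S * A * czGate S) * czProd l := by
      rw [czProd_cons, Matrix.conjTranspose_mul, czGate_conjTranspose]
      simp only [Matrix.mul_assoc]
    rw [key]
    rcases h S (by simp) with hS | hS
    · refine ih _ (mul_mem (mul_mem (czGate_mem_localAlg hS) hA) (czGate_mem_localAlg hS)) ?_
      intro T hT
      refine (h T (by simp [hT])).imp id fun hc => ?_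
      exact ((czGate_commute S T).mul_left hc).mul_left (czGate_commute S T)
    · rw [← hS.eq, Matrix.mul_assoc A, czGate_mul_self, Matrix.mul_one]
      exact ih A hA fun T hT => h T (by simp [hT])

theorem czProd_pullsBack {N : ℕ} {R R' : Set (Fin N)} (hR : R ⊆ R') {l : List (Finset (Fin N))}
    (h : ∀ S ∈ l, (S : Set _) ⊆ R' ∨ Disjoint (S : Set _) R) : PullsBack (czProd l) R R' := by
  intro A hA
  refine czProd_conj_mem l A (localAlg_mono hR hA) fun S hS => (h S hS).imp id fun hd => ?_
  refine commute_of_mem_localAlg hA fun i hi M => ?_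
  refine (commute_of_mem_localAlg (czGate_mem_localAlg subset_rfl) fun j hj M' => ?_).symm
  exact siteOp_commute (i := j) (j := i) (by rintro rfl; exact Set.disjoint_left.1 hd hj hi) _ _

/-! ### Frobenius norms and the input-averaged state -/

section Frobenius

open scoped Matrix.Norms.Frobenius

theorem frobenius_norm_sq {m m' : Type*} [Fintype m] [Fintype m'] (A : Matrix m m' ℂ) :
    ‖A‖ ^ 2 = ∑ y, ∑ x, ‖A y x‖ ^ 2 := by
  rw [Matrix.frobenius_norm_def, ← Real.sqrt_eq_rpow, Real.sq_sqrt (by positivity)]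
  simp

theorem trace_conj_diagonal {m m' : Type*} [Fintype m] [Fintype m'] [DecidableEq m]
    (A : Matrix m m' ℂ) (v : m → ℝ) :
    (Aᴴ * Matrix.diagonal (fun y => (v y : ℂ)) * A).trace = ∑ y, ∑ x, v y * (‖A y x‖ : ℂ) ^ 2 := by
  rw [Finset.sum_comm]
  refine Finset.sum_congr rfl fun x _ => ?_
  rw [Matrix.diag_apply, Matrix.mul_apply]
  refine Finset.sum_congr rfl fun y _ => ?_
  rw [Matrix.mul_diagonal, Matrix.conjTranspose_apply, ← Complex.conj_mul', starRingEnd_apply]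
  ring

theorem trace_conjTranspose_mul_self {m m' : Type*} [Fintype m] [Fintype m'] [DecidableEq m]
    (A : Matrix m m' ℂ) : (Aᴴ * A).trace = ((‖A‖ ^ 2 : ℝ) : ℂ) := by
  have := trace_conj_diagonal A 1
  simp only [Pi.one_apply, Complex.ofReal_one, Matrix.diagonal_one, Matrix.mul_one, one_mul] at this
  rw [this, frobenius_norm_sq]
  push_cast
  rfl

theorem frobenius_norm_unitary_mul {m m' : Type*} [Fintype m] [Fintype m'] [DecidableEq m]
    {U : Matrix m m ℂ} (hU : U ∈ Matrix.unitaryGroup m ℂ) (A : Matrix m m' ℂ) : ‖U * A‖ = ‖A‖ := by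
  have h1 : Uᴴ * U = 1 := Matrix.mem_unitaryGroup_iff'.1 hU
  have h : ((‖U * A‖ ^ 2 : ℝ) : ℂ) = ((‖A‖ ^ 2 : ℝ) : ℂ) := by
    rw [← trace_conjTranspose_mul_self, ← trace_conjTranspose_mul_self, Matrix.conjTranspose_mul,
      Matrix.mul_assoc, ← Matrix.mul_assoc Uᴴ, h1, Matrix.one_mul]
  exact (sq_eq_sq₀ (norm_nonneg _) (norm_nonneg _)).1 (by exact_mod_cast h)

/-- `czGate S - 1` is -2 times a projection dominated by `onesProj W`. Thus control over a small
part `W` of the support is enough, whatever the rest of the gate touches. -/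
theorem norm_czGate_sub_one_mul_sq_le {N : ℕ} {m : Type*} [Fintype m] {S W : Finset (Fin N)}
    (h : W ⊆ S) (A : Matrix (Bits N) m ℂ) :
    ‖(czGate S - 1) * A‖ ^ 2 ≤ 4 * (Aᴴ * onesProj W * A).trace.re := by
  have h1 : onesProj W =
      Matrix.diagonal fun y => ((if ∀ i ∈ W, y i = 1 then 1 else 0 : ℝ) : ℂ) := by
    rw [onesProj]
    congr 1
    ext1 y
    split_ifs <;> simp
  have h2 : (Aᴴ * onesProj W * A).trace =
      ((∑ y, ∑ x, (if ∀ i ∈ W, y i = 1 then 1 else 0 : ℝ) * ‖A y x‖ ^ 2 : ℝ) : ℂ) := by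
    rw [h1, trace_conj_diagonal]
    simp only [Complex.ofReal_sum, Complex.ofReal_mul, Complex.ofReal_pow]
  rw [h2, Complex.ofReal_re, frobenius_norm_sq, Finset.mul_sum]
  refine Finset.sum_le_sum fun y _ => ?_
  rw [Finset.mul_sum]
  refine Finset.sum_le_sum fun x _ => ?_
  rw [czGate, ← Matrix.diagonal_one, Matrix.diagonal_sub, Matrix.diagonal_mul, norm_mul, mul_pow,
    ← mul_assoc]
  gcongr
  by_cases hS : ∀ i ∈ S, y i = 1
  · rw [if_pos hS, if_pos fun i hi => hS i (h hi)]; norm_num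
  · rw [if_neg hS]
    split_ifs <;> norm_num

/-- Conjugation by a bit flip exchanges the two projections of a qubit, so a tracial functional
gives them equal weight and each new qubit of `W` halves the value. -/
theorem trace_onesProj {N : ℕ} {R : Set (Fin N)} (ω : QOp N →ₗ[ℂ] ℂ)
    (h : ∀ A ∈ localAlg R, ∀ B ∈ localAlg R, ω (A * B) = ω (B * A)) (W : Finset (Fin N))
    (hW : (W : Set _) ⊆ R) : 2 ^ W.card * ω (onesProj W) = ω 1 := by
  induction W using Finset.induction_on with
  | empty => simp [onesProj_empty]
  | insert i W hi ih =>
    have hWR : (W : Set _) ⊆ R := fun j hj => hW (by simpa using Or.inr hj)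
    have hiR : i ∈ R := hW (by simp)
    have hflip : bitFlip * bitProj 0 * bitFlip = bitProj 1 := by
      ext b c; fin_cases b <;> fin_cases c <;>
        simp [bitFlip, bitProj, Matrix.mul_apply, Matrix.diagonal_apply]
    have hflip2 : bitFlip * bitFlip = 1 := by
      ext b c; fin_cases b <;> fin_cases c <;> simp [bitFlip, Matrix.mul_apply]
    have hsum : bitProj 0 + bitProj 1 = 1 := by
      ext b c; fin_cases b <;> fin_cases c <;> simp [bitProj]
    have hcomm : onesProj W * siteOp i bitFlip = siteOp i bitFlip * onesProj W :=
      commute_of_mem_localAlg (onesProj_mem_localAlg subset_rfl) fun j hj M =>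
        siteOp_commute (by rintro rfl; exact hi hj) _ _
    have hs : ∀ M, siteOp i M ∈ localAlg R := siteOp_mem_localAlg hiR
    have h01 : ω (siteOp i (bitProj 1) * onesProj W) = ω (siteOp i (bitProj 0) * onesProj W) := by
      calc ω (siteOp i (bitProj 1) * onesProj W)
          = ω (siteOp i bitFlip * (siteOp i (bitProj 0) * (siteOp i bitFlip * onesProj W))) := by
            rw [← hflip, ← siteOp_mul, ← siteOp_mul]; simp only [Matrix.mul_assoc]
        _ = ω (siteOp i (bitProj 0) * (onesProj W * siteOp i bitFlip) * siteOp i bitFlip) := by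
            rw [h _ (hs _) _ (mul_mem (hs _) (mul_mem (hs _) (onesProj_mem_localAlg hWR))), hcomm]
        _ = _ := by
            rw [Matrix.mul_assoc, Matrix.mul_assoc, siteOp_mul, hflip2, siteOp_one, Matrix.mul_one]
    have htot : ω (siteOp i (bitProj 0) * onesProj W) + ω (siteOp i (bitProj 1) * onesProj W) =
        ω (onesProj W) := by
      rw [← map_add, ← Matrix.add_mul, ← siteOp_add, hsum, siteOp_one, Matrix.one_mul]
    rw [Finset.card_insert_of_notMem hi, onesProj_insert, ← ih hWR, ← htot, ← h01]
    ring

/-- The matrix whose columns are the initial states of the circuit on all inputs. -/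
noncomputable def stateMatrix {n N : ℕ} (e : Fin n ↪ Fin N) (φ : AncillaState e) :
    Matrix (Bits N) (Bits n) ℂ :=
  Matrix.of fun y x => initialState e φ x y

theorem siteOp_mul_stateMatrix {n N : ℕ} (e : Fin n ↪ Fin N) (φ : AncillaState e) (i : Fin n)
    (M : Matrix (Fin 2) (Fin 2) ℂ) :
    siteOp (e i) M * stateMatrix e φ = stateMatrix e φ * siteOp i M := by
  ext y x
  rw [siteOp_mul_apply, mul_siteOp_apply, Finset.sum_eq_single (x i), Finset.sum_eq_single (y (e i)),
    mul_comm]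
  · congr 1
    simp only [stateMatrix, Matrix.of_apply, initialState]
    have hanc : (fun q : Ancilla e => Function.update y (e i) (x i) q) = fun q : Ancilla e => y q := by
      ext1 q
      exact Function.update_of_ne (fun h => q.2 ⟨i, h.symm⟩) _ _
    rw [hanc]
    congr 1
    refine propext (forall_congr' fun j => ?_)
    by_cases hj : j = i
    · subst hj; simp
    · simp [hj]
  · intro b _ hb
    rw [stateMatrix, Matrix.of_apply, initialState, if_neg, zero_mul]
    exact fun h => hb (by simpa using (h i).symm)
  · simp
  · intro b _ hb
    rw [stateMatrix, Matrix.of_apply, initialState, if_neg, mul_zero]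
    exact fun h => hb (by simpa using h i)
  · simp

theorem siteOp_commute_stateMatrix {n N : ℕ} (e : Fin n ↪ Fin N) (φ : AncillaState e) (i : Fin n)
    (M : Matrix (Fin 2) (Fin 2) ℂ) :
    Commute (siteOp (e i) M) (stateMatrix e φ * (stateMatrix e φ)ᴴ) := by
  have h := congrArg Matrix.conjTranspose (siteOp_mul_stateMatrix e φ i Mᴴ)
  rw [Matrix.conjTranspose_mul, Matrix.conjTranspose_mul, siteOp_conjTranspose,
    siteOp_conjTranspose, Matrix.conjTranspose_conjTranspose] at h
  rw [Commute, SemiconjBy, ← Matrix.mul_assoc, siteOp_mul_stateMatrix, Matrix.mul_assoc, ← h,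
    Matrix.mul_assoc]

/-- This is cyclicity of the trace, together with the fact that Ψ Ψᴴ is trivial on the inputs and so
commutes with `B`. Only one of the two factors has to be local. -/
theorem trace_stateMatrix_comm {n N : ℕ} (e : Fin n ↪ Fin N) (φ : AncillaState e) {A B : QOp N}
    (hB : B ∈ localAlg (Set.range e)) :
    ((stateMatrix e φ)ᴴ * (A * B) * stateMatrix e φ).trace =
      ((stateMatrix e φ)ᴴ * (B * A) * stateMatrix e φ).trace := by
  set Ψ := stateMatrix e φ
  have h : B * (Ψ * Ψᴴ) = Ψ * Ψᴴ * B := by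
    refine commute_of_mem_localAlg hB ?_
    rintro _ ⟨i, rfl⟩ M
    exact siteOp_commute_stateMatrix e φ i M
  calc (Ψᴴ * (A * B) * Ψ).trace = (A * B * (Ψ * Ψᴴ)).trace := by
        rw [Matrix.mul_assoc, Matrix.trace_mul_comm, Matrix.mul_assoc]
    _ = (A * (Ψ * Ψᴴ) * B).trace := by rw [Matrix.mul_assoc, h, ← Matrix.mul_assoc]
    _ = (B * A * (Ψ * Ψᴴ)).trace := by rw [Matrix.trace_mul_comm, ← Matrix.mul_assoc]
    _ = (Ψᴴ * (B * A) * Ψ).trace := by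
        rw [Matrix.mul_assoc Ψᴴ, Matrix.trace_mul_comm Ψᴴ, Matrix.mul_assoc (B * A)]

theorem norm_stateMatrix_sq {n N : ℕ} (e : Fin n ↪ Fin N) (φ : AncillaState e) :
    ‖stateMatrix e φ‖ ^ 2 = 2 ^ n * ‖φ‖ ^ 2 := by
  classical
  have h1 : ∀ x : Bits n, ∑ y : Bits N, ‖stateMatrix e φ y x‖ ^ 2 = ‖φ‖ ^ 2 := by
    intro x
    let E := Equiv.piEquivPiSubtypeProd (· ∈ Set.range e) (fun _ : Fin N => Fin 2)
    -- The only assignment of the input qubits on which column `x` is nonzero.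
    let g : {q : Fin N // q ∈ Set.range e} → Fin 2 := fun q => x q.2.choose
    rw [← Equiv.sum_comp E.symm, Fintype.sum_prod_type, Finset.sum_eq_single g]
    · rw [EuclideanSpace.norm_sq_eq]
      refine Finset.sum_congr rfl fun v _ => ?_
      rw [stateMatrix, Matrix.of_apply, initialState, if_pos]
      · refine congrArg (fun w => ‖φ w‖ ^ 2) (funext fun q => ?_)
        exact dif_neg q.2
      · intro i
        have hi : e i ∈ Set.range e := ⟨i, rfl⟩
        have : E.symm (g, v) (e i) = g ⟨e i, hi⟩ := by
          simp [E, Equiv.piEquivPiSubtypeProd]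
        rw [this]
        exact congrArg x (e.injective hi.choose_spec)
    · intro u _ hu
      refine Finset.sum_eq_zero fun v _ => ?_
      rw [stateMatrix, Matrix.of_apply, initialState, if_neg, norm_zero]
      · norm_num
      · intro h
        refine hu (funext fun q => ?_)
        have h2 := h q.2.choose
        rw [q.2.choose_spec] at h2
        exact (dif_pos q.2).symm.trans h2
    · simp
  rw [frobenius_norm_sq, Finset.sum_comm, Finset.sum_congr rfl fun x _ => h1 x]
  simp

end Frobenius

/-! ### Intervals on the line -/

/-- The qubits at the positions from `l` up to, but not including, `u`. -/
def region (N l u : ℕ) : Set (Fin N) := {i | l ≤ i ∧ (i : ℕ) < u}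

/-- The set `S` contains `k` consecutive positions between `lo` and `hi`. -/
def ContainsWindow {N : ℕ} (lo hi k : ℕ) (S : Finset (Fin N)) : Prop :=
  ∃ t, lo ≤ t ∧ t + k ≤ hi ∧ ∀ i : Fin N, t ≤ i → (i : ℕ) < t + k → i ∈ S

/-- An interval that meets the region and also leaves its enlargement must contain all `k` positions
just outside one edge, which form a forbidden window. The alternatives `l = 0` and `N ≤ u` describe
edges at an end of the line, which nothing can cross; there the truncated `l - k` is still 0. -/
theorem subset_or_disjoint_of_not_containsWindow {N lo hi k l u : ℕ} {S : Finset (Fin N)}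
    (hS : ∃ a b : Fin N, a ≤ b ∧ S = Finset.Icc a b) (h : ¬ContainsWindow lo hi k S)
    (hl : l = 0 ∨ lo + k ≤ l ∧ l ≤ hi) (hu : N ≤ u ∨ lo ≤ u ∧ u + k ≤ hi) :
    (S : Set (Fin N)) ⊆ region N (l - k) (u + k) ∨ Disjoint (S : Set (Fin N)) (region N l u) := by
  obtain ⟨p, r, -, rfl⟩ := hS
  by_contra hcon
  push Not at hcon
  obtain ⟨h1, h2⟩ := hcon
  obtain ⟨j, hjS, hj⟩ := Set.not_subset.1 h1
  obtain ⟨i, hiS, hi'⟩ := Set.not_disjoint_iff.1 h2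
  simp only [Finset.coe_Icc, Set.mem_Icc, Fin.le_def] at hjS hiS
  simp only [region, Set.mem_ofPred_eq, not_and_or, not_le, not_lt] at hj hi'
  have hjN := j.2
  rcases hj with hj | hj
  · refine h ⟨l - k, by omega, by omega, fun v hv hv' => ?_⟩
    simp only [Finset.mem_Icc, Fin.le_def]
    omega
  · refine h ⟨u, by omega, by omega, fun v hv hv' => ?_⟩
    simp only [Finset.mem_Icc, Fin.le_def]
    omega

theorem length_le_card_of_pairwise_disjoint {α : Type*} [DecidableEq α] (l : List (Finset α)) :
    ∀ T : Finset α, l.Pairwise Disjoint → (∀ S ∈ l, ∃ i ∈ S, i ∈ T) → l.length ≤ T.card := by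
  induction l with
  | nil => simp
  | cons S l ih =>
    intro T hl hT
    rw [List.pairwise_cons] at hl
    have h1 := ih (T \ S) hl.2 fun S' hS' => by
      obtain ⟨i, hi, hiT⟩ := hT S' (by simp [hS'])
      exact ⟨i, hi, Finset.mem_sdiff.2 ⟨hiT, Finset.disjoint_right.1 (hl.1 S' hS') hi⟩⟩
    obtain ⟨i, hi, hiT⟩ := hT S (by simp)
    have h2 : (T \ S).card < T.card :=
      Finset.card_lt_card ⟨Finset.sdiff_subset, fun h => (Finset.mem_sdiff.1 (h hiT)).2 hi⟩
    rw [List.length_cons]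
    omega

/-- A contiguous placement of inputs occupies the positions from some `a` up to `a + n`. -/
theorem IsContiguous.exists_start {n N : ℕ} {e : Fin n ↪ Fin N} (he : IsContiguous e) (hn : 1 ≤ n) :
    ∃ a, a + n ≤ N ∧ Set.range e = region N a (a + n) := by
  have hne : (Finset.univ.map e).Nonempty := ⟨e ⟨0, hn⟩, by simp⟩
  set s := Finset.univ.map e with hs
  have hmem : ∀ i, i ∈ s ↔ i ∈ Set.range e := by simp [hs]
  have hIcc : s = Finset.Icc (s.min' hne) (s.max' hne) := by
    ext i
    rw [Finset.mem_Icc]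
    refine ⟨fun hi => ⟨s.min'_le i hi, s.le_max' i hi⟩, fun hi => ?_⟩
    rw [hmem]
    exact he.out ((hmem _).1 (s.min'_mem hne)) ((hmem _).1 (s.max'_mem hne)) hi
  have hcard : s.card = n := by simp [hs]
  have hle : s.min' hne ≤ s.max' hne := s.min'_le _ (s.max'_mem hne)
  rw [hIcc, Fin.card_Icc] at hcard
  have hlt := (s.max' hne).2
  rw [Fin.le_def] at hle
  refine ⟨s.min' hne, by omega, ?_⟩
  ext i
  have hi := Finset.ext_iff.1 hIcc i
  rw [Finset.mem_Icc, Fin.le_def, Fin.le_def, hmem] at hi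
  rw [hi, region, Set.mem_ofPred_eq]
  omega

/-! ### Deleting the long gates -/

section Frobenius

open scoped Matrix.Norms.Frobenius Classical

/-- Because the gates commute, each deleted gate can be moved so as to act directly on `A`. The
other factors are unitary, so the individual errors add. -/
theorem norm_czProd_sub_filter_mul_le {N : ℕ} {m : Type*} [Fintype m] (P : Finset (Fin N) → Prop)
    (A : Matrix (Bits N) m ℂ) {δ : ℝ} (l : List (Finset (Fin N)))
    (h : ∀ S ∈ l, P S → ‖(czGate S - 1) * A‖ ≤ δ) :
    ‖(czProd l - czProd (l.filter fun S => ¬P S)) * A‖ ≤ (l.filter fun S => P S).length * δ := by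
  induction l with
  | nil => simp [czProd]
  | cons S l ih =>
    have ih := ih fun T hT => h T (by simp [hT])
    set B := czProd (l.filter fun S => ¬P S) with hB
    have hG : ‖czGate S * ((czProd l - B) * A)‖ ≤ (l.filter fun S => P S).length * δ := by
      rwa [frobenius_norm_unitary_mul (czGate_mem_unitary S)]
    by_cases hS : P S
    · rw [List.filter_cons_of_neg (by simpa using hS), List.filter_cons_of_pos (by simpa using hS),
        ← hB, czProd_cons]
      have hc : B * czGate S = czGate S * B := czProd_commute_czGate _ S
      have : (czGate S * czProd l - B) * A =
          czGate S * ((czProd l - B) * A) + B * ((czGate S - 1) * A) := by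
        rw [← Matrix.mul_assoc, ← Matrix.mul_assoc, ← Matrix.add_mul, Matrix.mul_sub, Matrix.mul_sub,
          hc, Matrix.mul_one]
        congr 1
        abel
      rw [this]
      refine (norm_add_le _ _).trans ?_
      rw [frobenius_norm_unitary_mul (czProd_mem_unitary _) ((czGate S - 1) * A), List.length_cons]
      push_cast
      linarith [h S (by simp) hS]
    · rw [List.filter_cons_of_pos (by simpa using hS), List.filter_cons_of_neg (by simpa using hS),
        czProd_cons, czProd_cons, ← hB, ← Matrix.mul_sub, Matrix.mul_assoc]
      exact hG

theorem norm_czGate_sub_one_mul_stateMatrix_le {n N a lo hi k : ℕ} {e : Fin n ↪ Fin N}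
    {φ : AncillaState e} (hφ : ‖φ‖ = 1)
    (he : Set.range e = region N a (a + n)) (hhi : hi ≤ N) {U : QOp N}
    (hU : U ∈ Matrix.unitaryGroup (Bits N) ℂ)
    (hpull : PullsBack U (region N lo hi) (region N a (a + n))) {S : Finset (Fin N)}
    (hS : ContainsWindow lo hi k S) :
    ‖(czGate S - 1) * (U * stateMatrix e φ)‖ ≤ 2 * √(2 ^ n / 2 ^ k) := by
  obtain ⟨t, ht, htk, hw⟩ := hS
  set W : Finset (Fin N) := Finset.univ.filter fun i => t ≤ i ∧ (i : ℕ) < t + k with hW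
  have hWS : W ⊆ S := fun i hi => by
    simp only [hW, Finset.mem_filter, Finset.mem_univ, true_and] at hi
    exact hw i hi.1 hi.2
  have hWR : (W : Set (Fin N)) ⊆ region N lo hi := fun i hi => by
    simp only [hW, Finset.coe_filter, Finset.mem_univ, true_and, Set.mem_ofPred_eq] at hi
    exact ⟨by omega, by omega⟩
  have hWc : W.card = k := by
    have : W.map Fin.valEmbedding = Finset.Ico t (t + k) := by
      ext v
      simp only [hW, Finset.mem_map, Finset.mem_filter, Finset.mem_univ, true_and,
        Fin.valEmbedding_apply, Finset.mem_Ico]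
      constructor
      · rintro ⟨i, hi, rfl⟩; exact hi
      · intro hv; exact ⟨⟨v, by omega⟩, hv, rfl⟩
    rw [← Finset.card_map Fin.valEmbedding, this, Nat.card_Ico]
    omega
  set Ψ := stateMatrix e φ with hΨ
  let ω : QOp N →ₗ[ℂ] ℂ :=
    { toFun := fun A => ((U * Ψ)ᴴ * A * (U * Ψ)).trace
      map_add' := fun A B => by rw [Matrix.mul_add, Matrix.add_mul, Matrix.trace_add]
      map_smul' := fun c A => by
        rw [Matrix.mul_smul, Matrix.smul_mul, Matrix.trace_smul, RingHom.id_apply] }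
  have hω : ∀ A, ω A = (Ψᴴ * (Uᴴ * A * U) * Ψ).trace := fun A => by
    change ((U * Ψ)ᴴ * A * (U * Ψ)).trace = _
    rw [Matrix.conjTranspose_mul]
    simp only [Matrix.mul_assoc]
  -- Pulling back through `U` lands in the input algebra, so the functional is tracial on the whole
  -- zone.
  have htr := trace_onesProj ω (R := region N lo hi) (fun A _ B hB => by
    rw [hω, hω, ← conj_mul_conj hU, ← conj_mul_conj hU]
    exact trace_stateMatrix_comm e φ (he ▸ hpull B hB)) W hWR
  have h1 : ω 1 = ((2 ^ n : ℝ) : ℂ) := by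
    change ((U * Ψ)ᴴ * (1 : QOp N) * (U * Ψ)).trace = _
    rw [Matrix.mul_one, trace_conjTranspose_mul_self, frobenius_norm_unitary_mul hU,
      norm_stateMatrix_sq, hφ]
    simp
  have h2 : ω (onesProj W) = ((2 ^ n / 2 ^ k : ℝ) : ℂ) := by
    rw [hWc, h1] at htr
    push_cast at htr ⊢
    rw [← htr]
    field_simp
  have h3 := norm_czGate_sub_one_mul_sq_le hWS (U * Ψ)
  change _ ≤ 4 * (ω (onesProj W)).re at h3
  rw [h2, Complex.ofReal_re] at h3
  refine (pow_le_pow_iff_left₀ (norm_nonneg _) (by positivity) two_ne_zero).1 ?_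
  rw [mul_pow, Real.sq_sqrt (by positivity)]
  linarith

/-- Every circuit is close, on a uniformly random input, to an operator with a small light cone. -/
theorem exists_unitary_close_with_light_cone {n N a k : ℕ} {e : Fin n ↪ Fin N} {φ : AncillaState e}
    (hφ : ‖φ‖ = 1) (haN : a + n ≤ N) (he : Set.range e = region N a (a + n)) (hk : 1 ≤ k) {d : ℕ}
    (C : OneDQAC N d) (hd : 2 * (d * k) ≤ n) :
    ∃ U ∈ Matrix.unitaryGroup (Bits N) ℂ,
      ‖(C.op - U) * stateMatrix e φ‖ ≤ d * (n * (2 * √(2 ^ n / 2 ^ k))) ∧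
      ∀ l u, (l = 0 ∨ a + d * k ≤ l ∧ l + d * k ≤ a + n) →
        (N ≤ u ∨ a + d * k ≤ u ∧ u + d * k ≤ a + n) →
        PullsBack U (region N l u) (region N (l - d * k) (u + d * k)) := by
  induction C with
  | init L =>
    refine ⟨L.op, L.op_mem_unitary, by simp [OneDQAC.op], fun l u _ _ => ?_⟩
    simpa using L.pullsBack _
  | @layer d C M L ih =>
    rw [Nat.succ_mul d k] at hd ⊢
    generalize hD : d * k = D at *
    obtain ⟨U, hU, hnorm, hcone⟩ := ih (by omega)
    -- A gate is long if it fills a window in the zone whose observables still pull back to the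
    -- inputs under `U`; that zone has lost `D` positions at each end.
    set P : Finset (Fin N) → Prop := ContainsWindow (a + D) (a + n - D) k with hP
    set V := czProd (M.gates.filter fun S => ¬P S) with hV
    have hVu : V ∈ Matrix.unitaryGroup (Bits N) ℂ := czProd_mem_unitary _
    refine ⟨L.op * V * U, mul_mem (mul_mem L.op_mem_unitary hVu) hU, ?_, ?_⟩
    · set Ψ := stateMatrix e φ with hΨ
      set δ := 2 * √((2 : ℝ) ^ n / 2 ^ k) with hδ
      have hδ0 : 0 ≤ δ := by positivity
      have hpull : PullsBack U (region N (a + D) (a + n - D)) (region N a (a + n)) := by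
        have := hcone (a + D) (a + n - D) (Or.inr ⟨le_rfl, by omega⟩) (Or.inr ⟨by omega, by omega⟩)
        rwa [Nat.add_sub_cancel, Nat.sub_add_cancel (by omega)] at this
      have hdel := norm_czProd_sub_filter_mul_le P (U * Ψ) M.gates (δ := δ) fun S _ hS =>
        norm_czGate_sub_one_mul_stateMatrix_le hφ he (by omega) hU hpull hS
      -- As `k ≥ 1`, the first position of its window is an input qubit in each deleted gate, and
      -- the gates are disjoint.
      have hcount : (M.gates.filter fun S => P S).length ≤ n := by
        have := length_le_card_of_pairwise_disjoint (M.gates.filter fun S => P S)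
          (Finset.univ.map e) (M.disjoint.filter _) fun S hS => by
            obtain ⟨t, ht, htk, hw⟩ : P S := by simpa using (List.mem_filter.1 hS).2
            refine ⟨⟨t, by omega⟩, hw _ le_rfl (Nat.lt_add_of_pos_right hk), ?_⟩
            have : (⟨t, by omega⟩ : Fin N) ∈ Set.range e := by
              rw [he]; exact ⟨by simp; omega, by simp; omega⟩
            simpa using this
        simpa using this
      -- The new deletion error is measured on `U * Ψ`, the state of the already modified circuit,
      -- because only `U` has a controlled light cone.
      have hsplit : ((OneDQAC.layer C M L).op - L.op * V * U) * Ψ =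
          L.op * (czProd M.gates * ((C.op - U) * Ψ) + (czProd M.gates - V) * (U * Ψ)) := by
        change (L.op * czProd M.gates * C.op - L.op * V * U) * Ψ = _
        simp only [Matrix.mul_sub, Matrix.sub_mul, Matrix.mul_add, Matrix.mul_assoc]
        abel
      rw [hsplit, frobenius_norm_unitary_mul L.op_mem_unitary]
      refine (norm_add_le _ _).trans ?_
      rw [frobenius_norm_unitary_mul (czProd_mem_unitary _)]
      have hc : ((M.gates.filter fun S => P S).length : ℝ) * δ ≤ n * δ := by gcongr
      push_cast
      linarith
    · intro l u hl hu
      rw [Matrix.mul_assoc]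
      refine (L.pullsBack _).mul ?_
      have hVp : PullsBack V (region N l u) (region N (l - k) (u + k)) := by
        refine czProd_pullsBack ?_ fun S hS => ?_
        · intro i hi
          exact ⟨by have := hi.1; omega, by have := hi.2; omega⟩
        · obtain ⟨hSM, hSP⟩ := List.mem_filter.1 hS
          exact subset_or_disjoint_of_not_containsWindow (M.interval S hSM) (by simpa using hSP)
            (by omega) (by omega)
      have := hVp.mul (hcone (l - k) (u + k) (by omega) (by omega))
      rwa [show l - (D + k) = l - k - D by omega, show u + (D + k) = u + k + D by omega]

end Frobenius

/-! ### Parity at the output qubit -/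

/-- The part of a family of states, indexed by the inputs, on which the output qubit `q` holds the
parity of the input. -/
def parityPart {n N : ℕ} (q : Fin N) (G : Matrix (Bits N) (Bits n) ℂ) :
    Matrix (Bits N) (Bits n) ℂ :=
  Matrix.of fun y x => if y q = parity x then G y x else 0

theorem parityPart_sub {n N : ℕ} (q : Fin N) (G H : Matrix (Bits N) (Bits n) ℂ) :
    parityPart q G - parityPart q H = parityPart q (G - H) := by
  ext y x
  simp only [parityPart, Matrix.sub_apply, Matrix.of_apply]
  split_ifs <;> simp

theorem parity_update {n : ℕ} (x : Bits n) (i : Fin n) :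
    parity (Function.update x i (x i + 1)) = parity x + 1 := by
  rw [parity, parity, Finset.sum_update_of_mem (Finset.mem_univ i),
    ← Finset.add_sum_erase _ _ (Finset.mem_univ i), Finset.sdiff_singleton_eq_erase]
  abel

section Frobenius

open scoped Matrix.Norms.Frobenius

theorem norm_parityPart_le {n N : ℕ} (q : Fin N) (G : Matrix (Bits N) (Bits n) ℂ) :
    ‖parityPart q G‖ ≤ ‖G‖ := by
  refine (pow_le_pow_iff_left₀ (norm_nonneg _) (norm_nonneg _) two_ne_zero).1 ?_
  rw [frobenius_norm_sq, frobenius_norm_sq]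
  refine Finset.sum_le_sum fun y _ => Finset.sum_le_sum fun x _ => ?_
  rw [parityPart, Matrix.of_apply]
  split_ifs
  · exact le_rfl
  · simp

theorem norm_parityPart_sq {n N : ℕ} (q : Fin N) (G : Matrix (Bits N) (Bits n) ℂ) :
    ‖parityPart q G‖ ^ 2 = ∑ x, measureProb (fun y => G y x) q (parity x) := by
  rw [frobenius_norm_sq, Finset.sum_comm]
  refine Finset.sum_congr rfl fun x _ => ?_
  rw [measureProb, Finset.sum_filter]
  refine Finset.sum_congr rfl fun y _ => ?_
  rw [parityPart, Matrix.of_apply]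
  split_ifs <;> simp

theorem paritySuccess_eq {n N d : ℕ} (C : OneDQAC N d) (e : Fin n ↪ Fin N) (φ : AncillaState e)
    (q : Fin N) :
    paritySuccess C e φ q = ‖parityPart q (C.op * stateMatrix e φ)‖ ^ 2 / 2 ^ n := by
  rw [paritySuccess, norm_parityPart_sq]
  rfl

/-- Factor the difference of squares: the distance enters to the first power, and the sum of the
norms is at most twice `c`. -/
theorem norm_parityPart_sq_sub_le {n N : ℕ} (q : Fin N) {G H : Matrix (Bits N) (Bits n) ℂ} {c : ℝ}
    (hG : ‖G‖ = c) (hH : ‖H‖ = c) :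
    ‖parityPart q G‖ ^ 2 - ‖parityPart q H‖ ^ 2 ≤ ‖G - H‖ * (2 * c) := by
  have h1 : ‖parityPart q G‖ - ‖parityPart q H‖ ≤ ‖G - H‖ := by
    refine (norm_sub_norm_le _ _).trans ?_
    rw [parityPart_sub]
    exact norm_parityPart_le q _
  have h2 : ‖parityPart q G‖ + ‖parityPart q H‖ ≤ 2 * c := by
    linarith [norm_parityPart_le q G, norm_parityPart_le q H]
  calc _ = (‖parityPart q G‖ - ‖parityPart q H‖) * (‖parityPart q G‖ + ‖parityPart q H‖) := by ring
    _ ≤ _ := mul_le_mul h1 h2 (by positivity) (norm_nonneg _)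

theorem measureProb_eq_siteOp {n N : ℕ} (G : Matrix (Bits N) (Bits n) ℂ) (q : Fin N) (b : Fin 2)
    (x : Bits n) :
    (measureProb (fun y => G y x) q b : ℂ) = (Gᴴ * siteOp q (bitProj b) * G) x x := by
  rw [siteOp_bitProj, Matrix.mul_apply, measureProb, Finset.sum_filter, Complex.ofReal_sum]
  refine Finset.sum_congr rfl fun y _ => ?_
  rw [Matrix.mul_diagonal, Matrix.conjTranspose_apply]
  split_ifs
  · rw [mul_one, ← starRingEnd_apply, Complex.conj_mul', Complex.ofReal_pow]
  · simp

/-- If the light cone of the output qubit misses an input qubit, the parity of the input is guessed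
correctly with probability `1 / 2`. -/
theorem norm_parityPart_sq_of_light_cone {n N : ℕ} {e : Fin n ↪ Fin N} {φ : AncillaState e}
    (hφ : ‖φ‖ = 1) {U : QOp N} (hU : U ∈ Matrix.unitaryGroup (Bits N) ℂ) {q : Fin N}
    {R R' : Set (Fin N)} (hpull : PullsBack U R R') (hq : q ∈ R) {i : Fin n} (hi : e i ∉ R') :
    ‖parityPart q (U * stateMatrix e φ)‖ ^ 2 = 2 ^ n / 2 := by
  set Ψ := stateMatrix e φ with hΨ
  set σ : Bits n → Bits n := fun x => Function.update x i (x i + 1) with hσ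
  have htwo : ∀ b : Fin 2, b + 1 + 1 = b := by decide
  have hσσ : Function.Involutive σ := fun x => by simp [hσ, htwo]
  set f : Fin 2 → Bits n → ℝ := fun b x => measureProb (fun y => (U * Ψ) y x) q b with hf
  -- The probabilities are the diagonal entries of `B`. The pulled-back observable commutes with the
  -- flip of input `i`, and Ψ intertwines that flip with the flip on column indices, so `B` is
  -- invariant under it.
  have hinv : ∀ b x, f b (σ x) = f b x := by
    intro b x
    set B := (U * Ψ)ᴴ * siteOp q (bitProj b) * (U * Ψ) with hB
    have hBU : B = Ψᴴ * (Uᴴ * siteOp q (bitProj b) * U) * Ψ := by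
      rw [hB, Matrix.conjTranspose_mul]
      simp only [Matrix.mul_assoc]
    have hc : Commute (Uᴴ * siteOp q (bitProj b) * U) (siteOp (e i) bitFlip) :=
      commute_of_mem_localAlg (hpull _ (siteOp_mem_localAlg hq _)) fun j hj M =>
        siteOp_commute (by rintro rfl; exact hi hj) _ _
    have hflip : bitFlipᴴ = bitFlip := by
      ext b c; fin_cases b <;> fin_cases c <;> simp [bitFlip]
    have hadj : siteOp i bitFlip * Ψᴴ = Ψᴴ * siteOp (e i) bitFlip := by
      have := congrArg Matrix.conjTranspose (siteOp_mul_stateMatrix e φ i bitFlip)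
      rw [Matrix.conjTranspose_mul, Matrix.conjTranspose_mul, siteOp_conjTranspose,
        siteOp_conjTranspose, hflip] at this
      exact this.symm
    have hBX : siteOp i bitFlip * B = B * siteOp i bitFlip := by
      rw [hBU, Matrix.mul_assoc _ Ψ, hΨ, ← siteOp_mul_stateMatrix, ← hΨ, ← Matrix.mul_assoc,
        ← Matrix.mul_assoc, hadj, Matrix.mul_assoc Ψᴴ, ← hc.eq]
      simp only [Matrix.mul_assoc]
    have hflip_left : ∀ b c, bitFlip b c = if b = c + 1 then 1 else 0 := fun _ _ => rfl
    -- The entry at (x, σ x) of the commutation relation compares the diagonal entries of `B` at σ x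
    -- and at x.
    have hent := congrFun (congrFun hBX x) (σ x)
    rw [siteOp_mul_apply, mul_siteOp_apply, Finset.sum_eq_single (x i + 1),
      Finset.sum_eq_single (x i)] at hent
    · have hup : Function.update (σ x) i (x i) = x := by simp [hσ]
      rw [hup, hflip_left, hflip_left, if_pos (htwo _).symm, if_pos (by simp [hσ, htwo]), one_mul,
        mul_one] at hent
      have h1 := measureProb_eq_siteOp (U * Ψ) q b (σ x)
      have h2 := measureProb_eq_siteOp (U * Ψ) q b x
      rw [← hB] at h1 h2
      exact_mod_cast h1.trans (hent.trans h2.symm)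
    · intro c _ hc
      rw [hflip_left, if_neg, mul_zero]
      intro h
      exact hc (by simpa [hσ, htwo] using h)
    · simp
    · intro c _ hc
      rw [hflip_left, if_neg, zero_mul]
      intro h
      exact hc (by rw [h, htwo])
    · simp
  have htot : ∑ x, (f (parity x) x + f (parity x + 1) x) = 2 ^ n := by
    have h1 : ∀ x, f (parity x) x + f (parity x + 1) x = ∑ y, ‖(U * Ψ) y x‖ ^ 2 := by
      intro x
      have : ∀ b, f b x + f (b + 1) x = f 0 x + f 1 x := by
        intro b
        fin_cases b
        · rfl
        · exact add_comm _ _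
      rw [this, ← Fin.sum_univ_two (fun b => f b x)]
      exact Finset.sum_fiberwise Finset.univ (fun y : Bits N => y q) _
    rw [Finset.sum_congr rfl fun x _ => h1 x, Finset.sum_comm, ← frobenius_norm_sq,
      frobenius_norm_unitary_mul hU, norm_stateMatrix_sq, hφ]
    norm_num
  have hhalf : ∑ x, f (parity x + 1) x = ∑ x, f (parity x) x := by
    rw [← Equiv.sum_comp hσσ.toPerm fun x => f (parity x) x]
    refine Finset.sum_congr rfl fun x _ => ?_
    rw [Function.Involutive.coe_toPerm, hinv, parity_update]
  rw [norm_parityPart_sq]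
  change ∑ x, f (parity x) x = _
  rw [Finset.sum_add_distrib, hhalf] at htot
  linarith

theorem OneDQAC.op_mem_unitary {N d : ℕ} (C : OneDQAC N d) :
    C.op ∈ Matrix.unitaryGroup (Bits N) ℂ := by
  induction C with
  | init L => exact L.op_mem_unitary
  | layer C M L ih => exact mul_mem (mul_mem L.op_mem_unitary (czProd_mem_unitary _)) ih

theorem paritySuccess_le {n N d k : ℕ} (C : OneDQAC N d) {e : Fin n ↪ Fin N} {φ : AncillaState e}
    (q : Fin N) (he : IsContiguous e) (hφ : ‖φ‖ = 1) (hk : 1 ≤ k) (hd : 2 * (d * k) + 2 ≤ n) :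
    paritySuccess C e φ q ≤ 1 / 2 + 4 * d * n * (√(2 ^ k))⁻¹ := by
  obtain ⟨a, haN, hrange⟩ := he.exists_start (by omega)
  obtain ⟨U, hU, hnorm, hcone⟩ :=
    exists_unitary_close_with_light_cone hφ haN hrange hk C (by omega)
  generalize d * k = D at hd hcone
  have hCU := C.op_mem_unitary
  have hhalf : ‖parityPart q (U * stateMatrix e φ)‖ ^ 2 = 2 ^ n / 2 := by
    have hmem : ∀ p (hp : p < N), a ≤ p → p < a + n → ∃ i, e i = ⟨p, hp⟩ := fun p hp h1 h2 => by
      have : (⟨p, hp⟩ : Fin N) ∈ Set.range e := by rw [hrange]; exact ⟨h1, h2⟩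
      exact this
    -- Left of this threshold the cone ends before the last input. Otherwise 2D + 2 ≤ n gives q ≥ a
    -- + 1 + D, and the cone starts after the first input.
    by_cases hq : (q : ℕ) < a + n - 1 - D
    · obtain ⟨i, hi⟩ := hmem (a + n - 1) (by omega) (by omega) (by omega)
      refine norm_parityPart_sq_of_light_cone hφ hU
        (hcone 0 (a + n - 1 - D) (Or.inl rfl) (Or.inr ⟨by omega, by omega⟩)) ⟨by simp, hq⟩ (i := i) ?_
      rw [hi]
      intro h
      have := h.2
      simp only at this
      omega
    · obtain ⟨i, hi⟩ := hmem a (by omega) le_rfl (by omega)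
      refine norm_parityPart_sq_of_light_cone hφ hU
        (hcone (a + 1 + D) N (Or.inr ⟨by omega, by omega⟩) (Or.inl le_rfl)) ⟨by omega, q.2⟩
        (i := i) ?_
      rw [hi]
      intro h
      have := h.1
      simp only at this
      omega
  have hΨ : ‖stateMatrix e φ‖ = √(2 ^ n) := by
    rw [← Real.sqrt_sq (norm_nonneg (stateMatrix e φ)), norm_stateMatrix_sq, hφ]
    simp
  have hdiff := norm_parityPart_sq_sub_le q
    ((frobenius_norm_unitary_mul hCU _).trans hΨ) ((frobenius_norm_unitary_mul hU _).trans hΨ)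
  rw [← Matrix.sub_mul] at hdiff
  rw [paritySuccess_eq, div_le_iff₀ (by positivity)]
  have hs : √((2 : ℝ) ^ n) * √(2 ^ n) = 2 ^ n := Real.mul_self_sqrt (by positivity)
  have hfin : ‖(C.op - U) * stateMatrix e φ‖ * (2 * √(2 ^ n)) ≤
      4 * d * n * (√(2 ^ k))⁻¹ * 2 ^ n := by
    calc _ ≤ (d * (n * (2 * √(2 ^ n / 2 ^ k)))) * (2 * √(2 ^ n)) := by gcongr
      _ = 4 * d * n * (√(2 ^ k))⁻¹ * (√(2 ^ n) * √(2 ^ n)) := by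
        rw [Real.sqrt_div (by positivity)]; ring
      _ = _ := by rw [hs]
  rw [hhalf] at hdiff
  linarith

theorem paritySuccess_le_one {n N d : ℕ} (C : OneDQAC N d) {e : Fin n ↪ Fin N} {φ : AncillaState e}
    (q : Fin N) (hφ : ‖φ‖ = 1) : paritySuccess C e φ q ≤ 1 := by
  have h := pow_le_pow_left₀ (norm_nonneg _) (norm_parityPart_le q (C.op * stateMatrix e φ)) 2
  rw [frobenius_norm_unitary_mul C.op_mem_unitary, norm_stateMatrix_sq, hφ] at h
  rw [paritySuccess_eq, div_le_one (by positivity)]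
  simpa using h

end Frobenius

/-! ### Choice of the window length and the depth bound -/

theorem paritySuccess_le_rpow {n N d : ℕ} (C : OneDQAC N d) {e : Fin n ↪ Fin N}
    {φ : AncillaState e} (q : Fin N) (hn : 1 ≤ n) (hd : 1 ≤ d) (he : IsContiguous e)
    (hφ : ‖φ‖ = 1) :
    paritySuccess C e φ q ≤
      1 / 2 + 8 * (d : ℝ) * (n : ℝ) * (2 : ℝ) ^ (-((n : ℝ) / (10 * (d : ℝ)))) := by
  have hd' : (1 : ℝ) ≤ d := by exact_mod_cast hd
  have hn' : (1 : ℝ) ≤ n := by exact_mod_cast hn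
  have hdn : (1 : ℝ) ≤ d * n := one_le_mul_of_one_le_of_one_le hd' hn'
  -- For n ≤ 30d the power of 2 is at least 1/8, so the right side exceeds 1. This case is what
  -- needs the factor 8; the other one gives 4.
  by_cases hsmall : (n : ℝ) ≤ 30 * d
  · refine (paritySuccess_le_one C q hφ).trans ?_
    have h1 : (2 : ℝ) ^ (-3 : ℝ) ≤ (2 : ℝ) ^ (-((n : ℝ) / (10 * (d : ℝ)))) := by
      refine Real.rpow_le_rpow_of_exponent_le (by norm_num) ?_
      rw [neg_le_neg_iff, div_le_iff₀ (by positivity)]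
      linarith
    have h2 : (2 : ℝ) ^ (-3 : ℝ) = 1 / 8 := by
      rw [Real.rpow_neg (by norm_num)]; norm_num
    rw [h2] at h1
    nlinarith
  · push Not at hsmall
    -- Then 2^(-k/2) ≤ 2^(-n/(10d)), while 2dk + 2 ≤ 2n/5 + 2d + 2 ≤ n because d < n/30.
    set k := ⌈(n : ℝ) / (5 * d)⌉₊ with hk
    have hk1 : (n : ℝ) / (5 * d) ≤ k := Nat.le_ceil _
    have hk2 : (k : ℝ) < n / (5 * d) + 1 := Nat.ceil_lt_add_one (by positivity)
    have hk0 : 1 ≤ k := Nat.ceil_pos.2 (by positivity)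
    have hdk : 2 * (d * k) + 2 ≤ n := by
      have h1 : (d : ℝ) * k ≤ n / 5 + d := by
        calc (d : ℝ) * k ≤ d * (n / (5 * d) + 1) := by gcongr
          _ = n / 5 + d := by field_simp
      have h2 : (2 * (d * k) + 2 : ℝ) ≤ n := by linarith
      exact_mod_cast h2
    refine (paritySuccess_le C q he hφ hk0 hdk).trans ?_
    have hpow : (√((2 : ℝ) ^ k))⁻¹ ≤ (2 : ℝ) ^ (-((n : ℝ) / (10 * (d : ℝ)))) := by
      rw [Real.sqrt_eq_rpow, ← Real.rpow_natCast, ← Real.rpow_mul (by norm_num),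
        ← Real.rpow_neg (by norm_num)]
      refine Real.rpow_le_rpow_of_exponent_le (by norm_num) ?_
      have : (n : ℝ) / (10 * d) = n / (5 * d) * (1 / 2) := by field_simp; norm_num
      rw [this]
      linarith
    have h0 : (0 : ℝ) ≤ (2 : ℝ) ^ (-((n : ℝ) / (10 * (d : ℝ)))) := by positivity
    have : 4 * (d : ℝ) * n * (√((2 : ℝ) ^ k))⁻¹ ≤
        4 * (d : ℝ) * n * (2 : ℝ) ^ (-((n : ℝ) / (10 * (d : ℝ)))) := by gcongr
    nlinarith [mul_nonneg (mul_nonneg (Nat.cast_nonneg (α := ℝ) d) (Nat.cast_nonneg (α := ℝ) n)) h0]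

theorem depth_ge_of_paritySuccess {n N d : ℕ} (C : OneDQAC N d) {e : Fin n ↪ Fin N}
    {φ : AncillaState e} (q : Fin N) (hn : 2 ≤ n) (he : IsContiguous e) (hφ : ‖φ‖ = 1)
    (hs : 2 / 3 ≤ paritySuccess C e φ q) :
    Real.log 2 / 80 * ((n : ℝ) / Real.log n) ≤ d := by
  have hn' : (2 : ℝ) ≤ n := by exact_mod_cast hn
  have hl2 : 0 < Real.log 2 := Real.log_pos (by norm_num)
  have hln : Real.log 2 ≤ Real.log n := Real.log_le_log (by norm_num) hn'
  have hd : 1 ≤ d := by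
    -- At depth 0 the error term vanishes, so the success probability is at most 1/2.
    by_contra h0
    have h0 : d = 0 := by omega
    subst h0
    have := paritySuccess_le (k := 1) C q he hφ le_rfl (by omega)
    norm_num at this
    linarith
  have hd' : (1 : ℝ) ≤ d := by exact_mod_cast hd
  rw [← mul_div_assoc, div_le_iff₀ (by linarith)]
  by_cases hdn : (n : ℝ) ≤ d
  · have : Real.log 2 / 80 * (n : ℝ) ≤ Real.log n * n := by gcongr; linarith
    nlinarith
  push Not at hdn
  have h1 := hs.trans (paritySuccess_le_rpow C q (by omega) hd he hφ)
  set r : ℝ := (n : ℝ) / (10 * d) with hr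
  have hpos : (0 : ℝ) < 2 ^ r := by positivity
  rw [Real.rpow_neg (by norm_num)] at h1
  have h2 : (2 : ℝ) ^ r ≤ 48 * d * n := by
    have : 1 / 6 ≤ 8 * (d : ℝ) * n / 2 ^ r := by rw [div_eq_mul_inv (8 * (d : ℝ) * n)]; linarith
    rw [le_div_iff₀ hpos] at this
    linarith
  -- Here d < n and 48 ≤ 2^6 ≤ n^6. Taking logarithms, n log 2 / (10d) ≤ 8 log n, whence the
  -- constant 80.
  have h3 : (2 : ℝ) ^ r ≤ (n : ℝ) ^ 8 := by
    have h64 : (48 : ℝ) ≤ (n : ℝ) ^ 6 := by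
      calc (48 : ℝ) ≤ 2 ^ 6 := by norm_num
        _ ≤ _ := by gcongr
    calc (2 : ℝ) ^ r ≤ 48 * d * n := h2
      _ ≤ (n : ℝ) ^ 6 * n * n := by gcongr
      _ = _ := by ring
  have h4 := Real.log_le_log hpos h3
  rw [Real.log_rpow (by norm_num), Real.log_pow, hr, div_mul_eq_mul_div,
    div_le_iff₀ (by positivity)] at h4
  push_cast at h4
  linarith

theorem mainTheorem3 :
    (∀ (n d N : ℕ) (C : OneDQAC N d) (e : Fin n ↪ Fin N) (φ : AncillaState e) (q : Fin N),
      1 ≤ n → 1 ≤ d → IsContiguous e → ‖φ‖ = 1 →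
        paritySuccess C e φ q ≤
          1 / 2 + 8 * (d : ℝ) * (n : ℝ) * (2 : ℝ) ^ (-((n : ℝ) / (10 * (d : ℝ))))) ∧
    (∃ c : ℝ, 0 < c ∧
      ∀ (n d N : ℕ) (C : OneDQAC N d) (e : Fin n ↪ Fin N) (φ : AncillaState e) (q : Fin N),
        2 ≤ n → IsContiguous e → ‖φ‖ = 1 → 2 / 3 ≤ paritySuccess C e φ q →
          c * ((n : ℝ) / Real.log (n : ℝ)) ≤ (d : ℝ)) :=
  ⟨fun _ _ _ C _ _ q hn hd he hφ => paritySuccess_le_rpow C q hn hd he hφ,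
    Real.log 2 / 80, div_pos (Real.log_pos (by norm_num)) (by norm_num),
    fun _ _ _ C _ _ q hn he hφ hs => depth_ge_of_paritySuccess C q hn he hφ hs⟩
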